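/- Conventions. Let $\tau$ be a finite relational signature (finitely many relation symbols, each with an arity in $\mathbb{N}$) and let $T$ be a set of first-order $\tau$-sentences. Structures may have an empty domain. An atomic $\tau$-formula is $R(x_1,\dots,x_k)$ with $R\in\tau$ of arity $k$, or $x=y$, or $\bot$. $T$ is $\omega$-categorical if it has, up to isomorphism, exactly one countable (that is, finite or countably infinite) model. A sampling for $T$ is a sequence $(L_n)_{n\in\mathbb{N}}$ of finite sets of finite $\tau$-structures such that, for all $n\in\mathbb{N}$, a conjunction $\phi$ of atomic $\tau$-formulas with at most $n$ variables is satisfiable in some model of $T$ if and only if it is satisfiable in some $\mathfrak{B}\in L_n$. The sampling is equality-matching if, for all $n\in\mathbb{N}$, all conjunctions $\phi$ of atomic $\tau$-formulas and all conjunctions $\psi$ of equalities and negated equalities between variables, both on the same at most $n$ variables, $\phi\wedge\psi$ is satisfiable in some model of $T$ if and only if it is satisfiable in some $\mathfrak{B}\in L_n$. The orbit of a tuple $t\in A^n$ in a structure $\mathfrak{A}$ is $\{\alpha(t) : \alpha\in\mathrm{Aut}(\mathfrak{A})\}$, with $\alpha$ applied componentwise. Proposition. Let $T$ be an $\omega$-categorical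 theory with finite relational signature $\tau$. Then there exists an equality-matching sampling for $T$. Moreover, let $\mathfrak{A}$ be the countable model of $T$. For every $n\in\mathbb{N}$ there are only finitely many orbits of $n$-tuples in $\mathfrak{A}$. For each $n$, pick exactly one tuple from each orbit of $n$-tuples, in any way, and let $\mathfrak{B}_n$ be the substructure of $\mathfrak{A}$ whose domain consists of all entries of the picked tuples. Then $(\{\mathfrak{B}_n\})_{n\in\mathbb{N}}$ is an equality-matching sampling for $T$. -/

import Mathlib

open FirstOrder CategoryTheory
open FirstOrder.Language

universe u v w

namespace Sampling

variable {L : FirstOrder.Language.{u, v}}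

/-- A first-order theory is `ω`-categorical if, up to isomorphism, it has exactly one countable
model. Here "countable" means finite or countably infinite, and structures with empty domain
are allowed. -/
def IsOmegaCategorical (T : L.Theory) : Prop :=
  ∃ A : Bundled.{w} L.Structure, Countable A ∧ A ⊨ T ∧
    ∀ B : Bundled.{w} L.Structure, Countable B → B ⊨ T → Nonempty (A ≃[L] B)

/-- The conjunction of a finite list of formulas; the empty conjunction is `⊤`. -/
def conj {α : Type} (l : List (L.Formula α)) : L.Formula α :=
  l.foldr (· ⊓ ·) ⊤

/-- Conjunctions of atomic formulas. An atomic formula is an equality of terms, a relation symbol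
applied to terms, or `⊥`. (In a relational signature the only terms are variables.) -/
def IsAtomicConj {α : Type} (φ : L.Formula α) : Prop :=
  ∃ l : List (L.Formula α),
    (∀ θ ∈ l, BoundedFormula.IsAtomic θ ∨ θ = ⊥) ∧ φ = conj l

/-- Conjunctions of equalities `xᵢ = xⱼ` and negated equalities `¬ xᵢ = xⱼ` between variables. -/
def IsEqualityConj {α : Type} (ψ : L.Formula α) : Prop :=
  ∃ l : List (L.Formula α),
    (∀ θ ∈ l, ∃ i j : α,
      θ = (Term.var i).equal (Term.var j) ∨ θ = ((Term.var i).equal (Term.var j)).not) ∧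
    ψ = conj l

/-- The formula `φ` is satisfiable in the structure `M`. -/
def SatIn {α : Type} (φ : L.Formula α) (M : Type w) [L.Structure M] : Prop :=
  ∃ a : α → M, φ.Realize a

/-- The formula `φ` is satisfiable in some model of `T`. -/
def SatInSomeModel {α : Type} (T : L.Theory) (φ : L.Formula α) : Prop :=
  ∃ M : Bundled.{w} L.Structure, M ⊨ T ∧ SatIn φ M

/-- `S 0, S 1, …` is a sampling for `T`: each `S n` is a finite set of finite structures, and a
conjunction of atomic formulas with at most `n` variables is satisfiable in some model of `T`
if and only if it is satisfiable in some element of `S n`. -/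
structure IsSampling (T : L.Theory) (S : ℕ → Set (Bundled.{w} L.Structure)) : Prop where
  finite_set : ∀ n, (S n).Finite
  finite_sample : ∀ n, ∀ B ∈ S n, Finite B
  sat_iff : ∀ n, ∀ m ≤ n, ∀ φ : L.Formula (Fin m), IsAtomicConj φ →
    (SatInSomeModel.{u, v, w} T φ ↔ ∃ B ∈ S n, SatIn φ B)

/-- The sampling `S` for `T` is equality-matching: the defining equivalence also holds for
`φ ∧ ψ`, where `φ` is a conjunction of atomic formulas and `ψ` is a conjunction of equalities and
negated equalities, both on the same at most `n` variables. -/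
structure IsEqualityMatchingSampling (T : L.Theory) (S : ℕ → Set (Bundled.{w} L.Structure)) : Prop
    extends IsSampling T S where
  equality_matching : ∀ n, ∀ m ≤ n, ∀ φ ψ : L.Formula (Fin m),
    IsAtomicConj φ → IsEqualityConj ψ →
    (SatInSomeModel.{u, v, w} T (φ ⊓ ψ) ↔ ∃ B ∈ S n, SatIn (φ ⊓ ψ) B)

variable (L) in
/-- The orbit of the tuple `t` under the automorphism group of `A`, acting componentwise. -/
def orbit {A : Type w} [L.Structure A] {n : ℕ} (t : Fin n → A) : Set (Fin n → A) :=
  {s | ∃ f : A ≃[L] A, s = f ∘ t}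

variable (L) in
/-- The set of all orbits of `n`-tuples of `A`. -/
def orbits (A : Type w) [L.Structure A] (n : ℕ) : Set (Set (Fin n → A)) :=
  {O | ∃ t : Fin n → A, O = orbit L t}

variable (L) in
/-- `R` consists of exactly one tuple from each orbit of `n`-tuples of `A`. -/
def IsOrbitRepresentatives {A : Type w} [L.Structure A] {n : ℕ} (R : Set (Fin n → A)) : Prop :=
  ∀ O ∈ orbits L A n, ∃! t, t ∈ R ∧ t ∈ O

variable (L) in
/-- The substructure of `A` whose domain consists of all entries of the tuples in `R`. -/
def entriesSubstructure [L.IsRelational] {A : Type w} [L.Structure A] {n : ℕ}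
    (R : Set (Fin n → A)) : L.Substructure A where
  carrier := {a | ∃ t ∈ R, a ∈ Set.range t}
  fun_mem f := isEmptyElim f

end Sampling

/-! This is the Ryll-Nardzewski theorem followed by a transfer argument. Assignments of countably
many variables in the countable model `A` form a space whose basic open sets are defined by
formulas. Categoricity makes it compact (`Assignment.compactSpace`), hence Baire. If the type of a
finite tuple were not isolated, a generic assignment of `ℕ` would enumerate an elementary
substructure omitting that type; this is impossible, as the substructure is isomorphic to `A`
(`IsCountablyCategorical.hasIsolatedType`). Isolation drives a back-and-forth, so orbits are types
(`SameType.exists_equiv`), and compactness leaves finitely many of them.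

For the sampling, downward Löwenheim-Skolem reduces satisfiability in some model to satisfiability
in `A`. An automorphism then moves a satisfying tuple into the chosen representatives, and
quantifier-free formulas do not distinguish `A` from its substructures. -/

namespace Sampling

/-! ### The compact space of assignments. -/

section Types

variable {L : FirstOrder.Language.{u, v}} {A : Type w} [L.Structure A]

variable (L) in
/-- Two tuples have the same complete type in `A`. -/
def SameType {α : Type*} (a b : α → A) : Prop :=
  ∀ φ : L.Formula α, φ.Realize a ↔ φ.Realize b

theorem SameType.symm {α : Type*} {a b : α → A} (h : SameType L a b) : SameType L b a :=
  fun φ => (h φ).symm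

theorem SameType.comp {α β : Type*} {a b : α → A} (h : SameType L a b) (f : β → α) :
    SameType L (a ∘ f) (b ∘ f) := fun φ => by
  simpa only [Formula.realize_relabel] using h (φ.relabel f)

theorem SameType.of_forall_eq {α β : Type*} {a b : α → A} (h : SameType L a b) (f : β → α)
    {a' b' : β → A} (ha : ∀ i, a' i = a (f i)) (hb : ∀ i, b' i = b (f i)) :
    SameType L a' b' := by
  obtain rfl : a' = a ∘ f := funext ha
  obtain rfl : b' = b ∘ f := funext hb
  exact h.comp f

variable (L) in
/-- The type of the tuple `a` is isolated by a single formula. -/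
def HasIsolatedType {α : Type*} (a : α → A) : Prop :=
  ∃ θ : L.Formula α, θ.Realize a ∧ ∀ b : α → A, θ.Realize b → SameType L b a

/-- Assignments of the variables `α` in `A`, topologized so that the sets defined by formulas
form a basis. -/
structure Assignment (L : FirstOrder.Language.{u, v}) (α : Type*) (A : Type w) where
  /-- The underlying function. -/
  val : α → A

instance {α : Type*} : TopologicalSpace (Assignment L α A) :=
  TopologicalSpace.generateFrom {s | ∃ φ : L.Formula α, s = {x | φ.Realize x.val}}

theorem Assignment.isTopologicalBasis {α : Type*} :
    TopologicalSpace.IsTopologicalBasis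
      {s : Set (Assignment L α A) | ∃ φ : L.Formula α, s = {x | φ.Realize x.val}} where
  exists_subset_inter := by
    rintro _ ⟨φ, rfl⟩ _ ⟨ψ, rfl⟩ x hx
    exact ⟨_, ⟨φ ⊓ ψ, rfl⟩, by simpa using hx, fun y hy => by simpa using hy⟩
  sUnion_eq := by
    refine Set.eq_univ_of_forall fun x => ⟨_, ⟨⊤, rfl⟩, ?_⟩
    simp
  eq_generateFrom := rfl

theorem Assignment.isOpen_realize {α : Type*} (φ : L.Formula α) :
    IsOpen {x : Assignment L α A | φ.Realize x.val} :=
  Assignment.isTopologicalBasis.isOpen ⟨φ, rfl⟩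

theorem Assignment.dense_of_forall {α : Type*} {U : Set (Assignment L α A)}
    (h : ∀ (ψ : L.Formula α) (x : α → A), ψ.Realize x → ∃ y : α → A, ψ.Realize y ∧ ⟨y⟩ ∈ U) :
    Dense U := by
  refine Assignment.isTopologicalBasis.dense_iff.2 ?_
  rintro _ ⟨ψ, rfl⟩ ⟨x, hx⟩
  obtain ⟨y, hy⟩ := h ψ x.val hx
  exact ⟨⟨y⟩, hy⟩

/-- Assignments of the same type are inseparable, so the space is not Hausdorff in general; R1 is
enough for a compact space to be Baire. -/
instance {α : Type*} : R1Space (Assignment L α A) where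
  specializes_or_disjoint_nhds x y := by
    by_cases h : SameType L x.val y.val
    · left
      refine (Assignment.isTopologicalBasis.nhds_hasBasis.le_basis_iff
        Assignment.isTopologicalBasis.nhds_hasBasis).2 ?_
      rintro _ ⟨⟨φ, rfl⟩, hy⟩
      exact ⟨_, ⟨⟨φ, rfl⟩, (h φ).2 hy⟩, subset_rfl⟩
    · right
      obtain ⟨φ, hφ⟩ := not_forall.1 h
      have key : ∀ φ : L.Formula α, ∀ x y : Assignment L α A,
          φ.Realize x.val → ¬ φ.Realize y.val → Disjoint (nhds x) (nhds y) := by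
        intro φ x y hx hy
        refine Filter.disjoint_iff.2 ⟨_, (Assignment.isOpen_realize φ).mem_nhds hx, _,
          (Assignment.isOpen_realize φ.not).mem_nhds (Formula.realize_not.2 hy), ?_⟩
        exact Set.disjoint_left.2 fun z hz hz' => Formula.realize_not.1 hz' hz
      by_cases hx : φ.Realize x.val
      · exact key φ x y hx fun hy => hφ ⟨fun _ => hy, fun _ => hx⟩
      · have hy : φ.Realize y.val := by tauto
        exact (key φ y x hy hx).symm

variable (L A) in
/-- Every countable structure elementarily equivalent to `A` is isomorphic to `A`. -/
def IsCountablyCategorical : Prop :=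
  ∀ (B : Type w) [L.Structure B] [Countable B], A ≅[L] B → Nonempty (B ≃[L] A)

theorem exists_countable_elementarySubstructure [Countable L.Symbols] (s : Set A)
    (hs : s.Countable) : ∃ S : L.ElementarySubstructure A, s ⊆ S ∧ Countable S := by
  rcases finite_or_infinite A with hA | hA
  · exact ⟨⊤, fun _ _ => trivial, Subtype.countable⟩
  · obtain ⟨S, hsS, hS⟩ := exists_elementarySubstructure_card_eq L s Cardinal.aleph0.{w} le_rfl
      (by simpa using hs) (by
        rw [Cardinal.lift_aleph0, Cardinal.lift_le_aleph0]; exact Cardinal.mk_le_aleph0) (by simp)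
    refine ⟨S, hsS, ?_⟩
    rw [← Cardinal.mk_le_aleph0_iff]
    simpa using hS.le

/-- The limit of an ultrafilter is first realized in the ultrapower of `A` along it, then brought
back to `A` through a countable elementary substructure. -/
theorem Assignment.compactSpace [Countable L.Symbols] (hA : IsCountablyCategorical L A)
    (α : Type) [Countable α] : CompactSpace (Assignment L α A) := by
  refine ⟨isCompact_iff_ultrafilter_le_nhds.2 fun U _ => ?_⟩
  rcases isEmpty_or_nonempty A with hE | hE
  · obtain ⟨x, -⟩ := U.neBot.nonempty_of_mem Filter.univ_mem
    refine ⟨x, trivial, ?_⟩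
    rw [(Assignment.isTopologicalBasis.nhds_hasBasis (a := x)).ge_iff]
    rintro _ ⟨⟨φ, rfl⟩, hx⟩
    refine Filter.mem_of_superset Filter.univ_mem fun y _ => ?_
    have : y.val = x.val := Subsingleton.elim _ _
    exact (congrArg φ.Realize this).mpr hx
  · let M := (U : Filter (Assignment L α A)).Product fun _ => A
    -- By Łoś, `a` satisfies exactly the formulas that hold at `U`-almost every assignment.
    let a : α → M := fun i => Quotient.mk _ fun x => x.val i
    obtain ⟨S, haS, hS⟩ :=
      exists_countable_elementarySubstructure (L := L) (Set.range a) (Set.countable_range a)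
    have hAM : A ≅[L] M := by
      refine elementarilyEquivalent_iff.2 fun σ => ?_
      rw [Ultraproduct.sentence_realize]
      simp
    obtain ⟨e⟩ := hA S (hAM.trans S.elementarilyEquivalent.symm)
    let a' : α → S := fun i => ⟨a i, haS ⟨i, rfl⟩⟩
    refine ⟨⟨e ∘ a'⟩, trivial, ?_⟩
    rw [Assignment.isTopologicalBasis.nhds_hasBasis.ge_iff]
    rintro _ ⟨⟨φ, rfl⟩, hx⟩
    have h1 : φ.Realize a' := (StrongHomClass.realize_formula e φ).1 hx
    have h2 : φ.Realize a := (S.subtype.map_formula φ a').2 h1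
    exact (Ultraproduct.realize_formula_cast φ
      fun i (x : Assignment L α A) => x.val i).1 h2

end Types

/-! ### Omitting types by Baire category. -/

section Isolation

variable {L : FirstOrder.Language.{u, v}} {A : Type w} [L.Structure A]

variable (A) in
/-- The projection of a definable set along a finite tuple of variables is definable. -/
theorem exists_formula_realize_iff_comp [Nonempty A] {α β : Type*} [Finite α] (t : α → β)
    (ψ : L.Formula β) :
    ∃ θ : L.Formula α, ∀ z : α → A, θ.Realize z ↔ ∃ y : β → A, y ∘ t = z ∧ ψ.Realize y := by
  classical
  have := Fintype.ofFinite α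
  -- `β` may be infinite, so only the finitely many relevant variables are quantified; the others
  -- later receive an arbitrary value.
  let V : Finset β := ψ.freeVarFinset ∪ Finset.univ.image t
  have ht (i : α) : t i ∈ V := Finset.mem_union_right _ (by simp)
  let ψ' : L.Formula (α ⊕ V) :=
    ψ.restrictFreeVar fun i => Sum.inr ⟨i, Finset.mem_union_left _ i.2⟩
  let E : L.Formula (α ⊕ V) :=
    Formula.iInf fun i : α => (Term.var (Sum.inl i)).equal (Term.var (Sum.inr ⟨t i, ht i⟩))
  have hψ' (z : α → A) (y : β → A) :
      ψ'.Realize (Sum.elim z fun i : V => y i) ↔ ψ.Realize y :=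
    BoundedFormula.realize_restrictFreeVar y (by simp)
  refine ⟨(E ⊓ ψ').iExs V, fun z => ?_⟩
  rw [Formula.realize_iExs]
  have hE (z : α → A) (y : V → A) :
      E.Realize (Sum.elim z y) ↔ ∀ i, z i = y ⟨t i, ht i⟩ := by
    simp [E, Formula.realize_iInf]
  simp only [Formula.realize_inf, hE]
  constructor
  · rintro ⟨y, hy, h⟩
    let y' : β → A := fun b => if hb : b ∈ V then y ⟨b, hb⟩ else Classical.arbitrary A
    have hy' : y = fun i : V => y' i := by
      ext i
      simp [y']
    refine ⟨y', ?_, ?_⟩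
    · ext i
      simp [hy, y', ht]
    · rwa [hy', hψ'] at h
  · rintro ⟨y, rfl, h⟩
    exact ⟨fun i => y i, fun _ => rfl, (hψ' _ _).2 h⟩

theorem realize_update_of_notMem_freeVarFinset {β : Type*} [DecidableEq β] {ψ : L.Formula β}
    {x : β → A} {m : β} (hm : m ∉ ψ.freeVarFinset) (a : A) :
    ψ.Realize (Function.update x m a) ↔ ψ.Realize x := by
  have h (y : β → A) (hy : ∀ b ∈ ψ.freeVarFinset, y b = x b) :
      (ψ.restrictFreeVar id).Realize (M := A) (fun b => x b) default ↔ ψ.Realize y :=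
    BoundedFormula.realize_restrictFreeVar y fun b => (hy b b.2).symm
  rw [← h (Function.update x m a), ← h x fun _ _ => rfl]
  intro b hb
  rw [Function.update_of_ne]
  rintro rfl
  exact hm hb

variable (L A) in
/-- The assignments which provide a witness for `φ(x, t)`. -/
def witnessSet {n : ℕ} (φ : L.BoundedFormula Empty (n + 1)) (t : Fin n → ℕ) :
    Set (Assignment L ℕ A) :=
  {x | ∀ a : A, φ.Realize default (Fin.snoc (x.val ∘ t) a : _ → A) →
    ∃ m, φ.Realize default (Fin.snoc (x.val ∘ t) (x.val m) : _ → A)}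

theorem realize_relabel_toFormula {n : ℕ} (φ : L.BoundedFormula Empty n) (s : Fin n → ℕ)
    (x : ℕ → A) :
    (φ.toFormula.relabel (Sum.elim Empty.elim s)).Realize x ↔ φ.Realize default (x ∘ s) := by
  rw [Formula.realize_relabel, BoundedFormula.realize_toFormula]
  exact iff_of_eq (congrArg₂ _ (Subsingleton.elim _ _) rfl)

theorem isOpen_witnessSet {n : ℕ} (φ : L.BoundedFormula Empty (n + 1)) (t : Fin n → ℕ) :
    IsOpen (witnessSet L A φ t) := by
  have h : witnessSet L A φ t =
      {x | ((φ.ex.toFormula.relabel (Sum.elim Empty.elim t)).not).Realize x.val} ∪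
      ⋃ m, {x | (φ.toFormula.relabel
        (Sum.elim Empty.elim (Fin.snoc t m : Fin (n + 1) → ℕ))).Realize x.val} := by
    ext x
    simp only [witnessSet, Set.mem_ofPred_eq, Set.mem_union, Set.mem_iUnion, Formula.realize_not,
      realize_relabel_toFormula, BoundedFormula.realize_ex, Fin.comp_snoc]
    rw [← imp_iff_not_or, forall_exists_index]
  rw [h]
  exact (Assignment.isOpen_realize _).union
    (isOpen_iUnion fun m => Assignment.isOpen_realize _)

theorem dense_witnessSet {n : ℕ} (φ : L.BoundedFormula Empty (n + 1)) (t : Fin n → ℕ) :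
    Dense (witnessSet L A φ t) := by
  classical
  refine Assignment.dense_of_forall fun ψ x hx => ?_
  by_cases h : ∃ a : A, φ.Realize default (Fin.snoc (x ∘ t) a : _ → A)
  · obtain ⟨a, ha⟩ := h
    -- A fresh variable `m` can be given the witness as its value without disturbing `ψ` or the
    -- parameters.
    obtain ⟨m, hm⟩ := Infinite.exists_notMem_finset (ψ.freeVarFinset ∪ Finset.univ.image t)
    simp only [Finset.mem_union, Finset.mem_image, Finset.mem_univ, true_and, not_or,
      not_exists] at hm
    refine ⟨Function.update x m a, (realize_update_of_notMem_freeVarFinset hm.1 a).2 hx,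
      fun _ _ => ⟨m, ?_⟩⟩
    have : Function.update x m a ∘ t = x ∘ t := by
      ext i
      simp [Function.update_of_ne (hm.2 i)]
    simpa [this] using ha
  · exact ⟨x, hx, fun a ha => absurd ⟨a, ha⟩ h⟩

variable (L) in
/-- The assignments in which the variables `t` do not realize the type of `p`. -/
def omitSet {α : Type*} (p : α → A) (t : α → ℕ) : Set (Assignment L ℕ A) :=
  {x | ∃ φ : L.Formula α, φ.Realize p ∧ ¬ φ.Realize (x.val ∘ t)}

theorem isOpen_omitSet {α : Type*} (p : α → A) (t : α → ℕ) : IsOpen (omitSet L p t) := by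
  have h : omitSet L p t = ⋃ φ : {φ : L.Formula α // φ.Realize p},
      {x | ((φ.1.relabel t).not).Realize x.val} := by
    ext x
    simp [omitSet, Formula.realize_relabel]
  rw [h]
  exact isOpen_iUnion fun φ => Assignment.isOpen_realize _

theorem dense_omitSet {α : Type*} [Finite α] [Nonempty A] {p : α → A}
    (hp : ¬ HasIsolatedType L p) (t : α → ℕ) : Dense (omitSet L p t) := by
  refine Assignment.dense_of_forall fun ψ x hx => ?_
  by_cases h : (⟨x⟩ : Assignment L ℕ A) ∈ omitSet L p t
  · exact ⟨x, hx, h⟩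
  have h' (φ : L.Formula α) (hφ : φ.Realize p) : φ.Realize (x ∘ t) := by
    by_contra hφ'
    exact h ⟨φ, hφ, hφ'⟩
  -- `θ` defines the possible values of the variables `t` under `ψ`. It belongs to the type of `p`
  -- but cannot isolate it, so some other type is available for `t`.
  obtain ⟨θ, hθ⟩ := exists_formula_realize_iff_comp A t ψ
  have hθp : θ.Realize p := by
    by_contra hn
    exact h' θ.not hn ((hθ _).2 ⟨x, rfl, hx⟩)
  obtain ⟨q, hq, hqp⟩ : ∃ q : α → A, θ.Realize q ∧ ¬ SameType L q p := by
    by_contra! hn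
    exact hp ⟨θ, hθp, hn⟩
  obtain ⟨y, rfl, hy⟩ := (hθ q).1 hq
  refine ⟨y, hy, ?_⟩
  by_contra hn
  refine hqp fun φ => ⟨fun h1 => ?_, fun h1 => ?_⟩
  · by_contra h2
    exact hn ⟨φ.not, h2, fun h3 => h3 h1⟩
  · by_contra h2
    exact hn ⟨φ, h1, h2⟩

/-- In a countably categorical structure, all types of finite tuples are isolated: otherwise,
some countable elementary substructure omits a type that is realized. -/
theorem IsCountablyCategorical.hasIsolatedType [L.IsRelational] [Countable L.Symbols]
    (hA : IsCountablyCategorical L A) {α : Type*} [Finite α] (p : α → A) :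
    HasIsolatedType L p := by
  rcases isEmpty_or_nonempty A with hE | hE
  · refine ⟨⊤, by simp, fun b _ => ?_⟩
    rw [Subsingleton.elim b p]
    exact fun _ => Iff.rfl
  by_contra hp
  have := Assignment.compactSpace hA ℕ
  have hd : Dense ((⋂ φ : (Σ n, L.BoundedFormula Empty (n + 1)), ⋂ t : Fin φ.1 → ℕ,
      witnessSet L A φ.2 t) ∩ ⋂ t : α → ℕ, omitSet L p t) := by
    have hc : Countable (Σ n, L.BoundedFormula Empty (n + 1)) :=
      Function.Injective.countable
        (f := fun φ => (⟨φ.1 + 1, φ.2⟩ : Σ n, L.BoundedFormula Empty n)) (by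
          rintro ⟨n, φ⟩ ⟨m, ψ⟩ h
          simp only [Sigma.mk.injEq, add_left_inj] at h
          obtain ⟨rfl, h⟩ := h
          rw [eq_of_heq h])
    have ho : ∀ φ : (Σ n, L.BoundedFormula Empty (n + 1)), IsGδ (⋂ t : Fin φ.1 → ℕ,
      witnessSet L A φ.2 t) := fun φ => .iInter fun t => (isOpen_witnessSet φ.2 t).isGδ
    refine Dense.inter_of_Gδ (.iInter ho) (.iInter fun t => (isOpen_omitSet p t).isGδ)
      (dense_iInter_of_Gδ ho fun φ =>
        dense_iInter_of_isOpen (fun t => isOpen_witnessSet φ.2 t) fun t => dense_witnessSet φ.2 t)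
      (dense_iInter_of_isOpen (fun t => isOpen_omitSet p t) fun t => dense_omitSet hp t)
  have : Nonempty (Assignment L ℕ A) := ⟨⟨fun _ => Classical.arbitrary A⟩⟩
  obtain ⟨x, hx, hx'⟩ := hd.nonempty
  simp only [Set.mem_iInter] at hx hx'
  let S : L.Substructure A := ⟨Set.range x.val, fun f => isEmptyElim f⟩
  -- Tarski-Vaught: genericity of `x` provides the witnesses inside its range.
  have hS : S.IsElementary := by
    refine S.isElementary_of_exists fun n φ y a ha => ?_
    choose t ht using fun i => (y i).2
    have hy : x.val ∘ t = (↑) ∘ y := funext ht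
    rw [← hy] at ha ⊢
    obtain ⟨m, hm⟩ := hx ⟨n, φ⟩ t a ha
    exact ⟨⟨x.val m, m, rfl⟩, hm⟩
  let S' : L.ElementarySubstructure A := ⟨S, hS⟩
  have : Countable S' := (Set.countable_range x.val).to_subtype
  obtain ⟨e⟩ := hA S' S'.elementarilyEquivalent.symm
  choose t ht using fun i => (e.symm (p i)).2
  obtain ⟨φ, hφ, hφ'⟩ := hx' t
  apply hφ'
  have hy : x.val ∘ t = S'.subtype ∘ e.symm ∘ p := funext ht
  rw [hy, S'.subtype.map_formula]
  exact (StrongHomClass.realize_formula e.symm φ).2 hφ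

end Isolation

/-! ### Back-and-forth, orbits and their representatives. -/

section Orbits

variable {L : FirstOrder.Language.{u, v}} {A : Type w} [L.Structure A]

/-- If `θ` isolates the type of `(a, c)`, then `∃ y, θ(x, y)` passes from `a` to `b`, and any
witness at `b` has the right type. -/
theorem SameType.exists_extend [Nonempty A] {α : Type*} [Finite α]
    (hiso : ∀ p : α ⊕ Unit → A, HasIsolatedType L p) {a b : α → A} (h : SameType L a b) (c : A) :
    ∃ d, SameType L (Sum.elim a fun _ : Unit => c) (Sum.elim b fun _ : Unit => d) := by
  obtain ⟨θ, hθ, hθ'⟩ := hiso (Sum.elim a fun _ => c)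
  obtain ⟨χ, hχ⟩ := exists_formula_realize_iff_comp A (Sum.inl : α → α ⊕ Unit) θ
  have h1 : χ.Realize b := (h χ).1 ((hχ a).2 ⟨_, rfl, hθ⟩)
  obtain ⟨y, rfl, hy⟩ := (hχ b).1 h1
  refine ⟨y (Sum.inr ()), ?_⟩
  convert! (hθ' y hy).symm using 1
  ext (i | i) <;> rfl

variable (L) in
/-- A finite partial elementary map, given by its graph. -/
def IsPartialElementary (F : Finset (A × A)) : Prop :=
  SameType L (fun z : F => z.1.1) (fun z : F => z.1.2)

theorem IsPartialElementary.exists_insert [Nonempty A] {F : Finset (A × A)} [DecidableEq (A × A)]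
    (hiso : ∀ p : F ⊕ Unit → A, HasIsolatedType L p) (hF : IsPartialElementary L F) (c : A) :
    ∃ d, IsPartialElementary L (insert (c, d) F) := by
  obtain ⟨d, hd⟩ := hF.exists_extend hiso c
  refine ⟨d, ?_⟩
  let g : ↥(insert (c, d) F) → F ⊕ Unit := fun z =>
    if hz : z.1 ∈ F then Sum.inl ⟨z.1, hz⟩ else Sum.inr ()
  have hz' (z : ↥(insert (c, d) F)) (hz : z.1 ∉ F) : z.1 = (c, d) := by
    exact (Finset.mem_insert.1 z.2).resolve_right hz
  refine hd.of_forall_eq g (fun z => ?_) fun z => ?_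
  · by_cases hz : z.1 ∈ F
    · simp [g, hz]
    · rw [hz' z hz]
      simp [g, hz]
  · by_cases hz : z.1 ∈ F
    · simp [g, hz]
    · rw [hz' z hz]
      simp [g, hz]

theorem IsPartialElementary.swap {F : Finset (A × A)} [DecidableEq (A × A)]
    (hF : IsPartialElementary L F) : IsPartialElementary L (F.image Prod.swap) := by
  let g : ↥(F.image Prod.swap) → F := fun z => ⟨z.1.swap, by
    obtain ⟨y, hy, hyz⟩ := Finset.mem_image.1 z.2
    rw [← hyz, Prod.swap_swap]
    exact hy⟩
  exact (hF.comp g).symm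

theorem IsPartialElementary.exists_insert' [Nonempty A] {F : Finset (A × A)}
    [DecidableEq (A × A)]
    (hiso : ∀ p : ↥(F.image Prod.swap) ⊕ Unit → A, HasIsolatedType L p)
    (hF : IsPartialElementary L F) (d : A) :
    ∃ c, IsPartialElementary L (insert (c, d) F) := by
  obtain ⟨c, hc⟩ := hF.swap.exists_insert hiso d
  refine ⟨c, ?_⟩
  have := hc.swap
  rwa [Finset.image_insert, Finset.image_image, Prod.swap_swap_eq, Finset.image_id] at this

/-- Back-and-forth: in a countable structure in which all types of finite tuples are isolated,
tuples of the same type are conjugate under an automorphism. -/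
theorem SameType.exists_equiv [L.IsRelational] [Countable A]
    (hiso : ∀ (α : Type w) [Finite α] (p : α → A), HasIsolatedType L p)
    {ι : Type*} [Finite ι] {a b : ι → A} (h : SameType L a b) : ∃ f : A ≃[L] A, b = f ∘ a := by
  classical
  rcases isEmpty_or_nonempty A with hE | hE
  · exact ⟨Language.Equiv.refl L A, Subsingleton.elim _ _⟩
  have := Fintype.ofFinite ι
  let P := {F : Finset (A × A) // IsPartialElementary L F}
  let F₀ : P := ⟨Finset.univ.image fun i => (a i, b i), by
    have hex (z : ↥(Finset.univ.image fun i => (a i, b i))) : ∃ i, (a i, b i) = z.1 := by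
      simpa only [Finset.mem_image, Finset.mem_univ, true_and] using! z.2
    choose g hg using hex
    refine h.of_forall_eq g (fun z => ?_) fun z => ?_
    · rw [← hg z]
    · rw [← hg z]⟩
  let 𝒟 : A ⊕ A → Order.Cofinal P := fun s =>
    { carrier := Sum.elim (fun c => {F : P | ∃ d, (c, d) ∈ F.1})
        (fun d => {F : P | ∃ c, (c, d) ∈ F.1}) s
      isCofinal := by
        rintro ⟨F, hF⟩
        rcases s with c | d
        · obtain ⟨d, hd⟩ := hF.exists_insert (fun p => hiso _ p) c
          exact ⟨⟨_, hd⟩, ⟨d, Finset.mem_insert_self _ _⟩, Finset.subset_insert _ _⟩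
        · obtain ⟨c, hc⟩ := hF.exists_insert' (fun p => hiso _ p) d
          exact ⟨⟨_, hc⟩, ⟨c, Finset.mem_insert_self _ _⟩, Finset.subset_insert _ _⟩ }
  have := Encodable.ofCountable (A ⊕ A)
  let s : ℕ → P := Order.sequenceOfCofinals F₀ 𝒟
  have hs : Monotone s := Order.sequenceOfCofinals.monotone F₀ 𝒟
  -- Finitely many pairs from an increasing chain lie in a single stage, so the union of the chain
  -- is elementary.
  have hG {κ : Type} [Finite κ] (x y : κ → A) (hxy : ∀ k, ∃ n, (x k, y k) ∈ (s n).1) :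
      SameType L x y := by
    choose n hn using hxy
    obtain ⟨N, hN⟩ := (Set.finite_range n).bddAbove
    exact (s N).2.comp fun k => (⟨(x k, y k), hs (hN ⟨k, rfl⟩) (hn k)⟩ : (s N).1)
  have heq {x x' y y' : A} {n m : ℕ} (h : (x, y) ∈ (s n).1) (h' : (x', y') ∈ (s m).1) :
      x = x' ↔ y = y' := by
    -- Preservation of the formula `x₀ = x₁` makes the union single-valued and injective.
    have := hG ![x, x'] ![y, y'] (by
      intro k
      fin_cases k
      exacts [⟨n, h⟩, ⟨m, h'⟩]) ((Term.var 0).equal (Term.var 1))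
    simpa [Formula.realize_equal] using this
  have hl (c : A) : ∃ d n, (c, d) ∈ (s n).1 := by
    obtain ⟨d, hd⟩ := Order.sequenceOfCofinals.encode_mem F₀ 𝒟 (Sum.inl c)
    exact ⟨d, _, hd⟩
  have hr (d : A) : ∃ c n, (c, d) ∈ (s n).1 := by
    obtain ⟨c, hc⟩ := Order.sequenceOfCofinals.encode_mem F₀ 𝒟 (Sum.inr d)
    exact ⟨c, _, hc⟩
  choose f nf hf using hl
  choose g ng hg using hr
  refine ⟨⟨⟨f, g, fun c => (heq (hg (f c)) (hf c)).2 rfl, fun d => (heq (hf (g d)) (hg d)).1 rfl⟩,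
    fun r => isEmptyElim r, fun {n} r x => ?_⟩, ?_⟩
  · have := hG x (f ∘ x) (fun k => ⟨_, hf (x k)⟩) (r.formula fun i => Term.var i)
    simpa [Formula.realize_rel, Function.comp_def] using this.symm
  · ext i
    have h0 : (a i, b i) ∈ (s 0).1 := Finset.mem_image_of_mem _ (Finset.mem_univ i)
    exact (heq h0 (hf (a i))).1 rfl

theorem self_mem_orbit {n : ℕ} (t : Fin n → A) : t ∈ orbit L t := ⟨Language.Equiv.refl L A, rfl⟩

theorem orbit_eq_of_mem {n : ℕ} {s t : Fin n → A} (h : s ∈ orbit L t) :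
    orbit L s = orbit L t := by
  obtain ⟨f, rfl⟩ := h
  ext x
  constructor
  · rintro ⟨g, rfl⟩
    exact ⟨g.comp f, rfl⟩
  · rintro ⟨g, rfl⟩
    refine ⟨g.comp f.symm, ?_⟩
    ext i
    simp

/-- The sets defined by isolating formulas form an open cover, and each lies within a single orbit;
a finite subcover bounds the number of orbits. -/
theorem IsCountablyCategorical.finite_orbits [L.IsRelational] [Countable L.Symbols] [Countable A]
    (hA : IsCountablyCategorical L A) (n : ℕ) : (orbits L A n).Finite := by
  have := Assignment.compactSpace hA (Fin n)
  choose θ hθ hθ' using fun x : Assignment L (Fin n) A => hA.hasIsolatedType x.val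
  obtain ⟨F, hF⟩ := CompactSpace.elim_nhds_subcover _
    fun x => (Assignment.isOpen_realize (θ x)).mem_nhds (hθ x)
  refine (F.finite_toSet.image fun x => orbit L x.val).subset ?_
  rintro _ ⟨t, rfl⟩
  have ht : (⟨t⟩ : Assignment L (Fin n) A) ∈ (⊤ : Set (Assignment L (Fin n) A)) := trivial
  rw [← hF] at ht
  simp only [Set.mem_iUnion] at ht
  obtain ⟨x, hx, htx⟩ := ht
  refine ⟨x, hx, (orbit_eq_of_mem ?_).symm⟩
  exact (hθ' x t htx).symm.exists_equiv fun α _ p => hA.hasIsolatedType p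

variable (L A) in
theorem exists_isOrbitRepresentatives (n : ℕ) :
    ∃ R : Set (Fin n → A), IsOrbitRepresentatives L R := by
  have h (O : orbits L A n) : ∃ t, O.1 = orbit L t := O.2
  choose r hr using h
  refine ⟨Set.range r, fun O hO => ⟨r ⟨O, hO⟩, ⟨⟨_, rfl⟩, ?_⟩, ?_⟩⟩
  · exact (hr ⟨O, hO⟩).ge (self_mem_orbit _)
  · rintro _ ⟨⟨O', rfl⟩, hO'⟩
    congr 1
    obtain ⟨t, rfl⟩ := hO
    ext1
    rw [hr O', orbit_eq_of_mem hO']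

theorem IsOrbitRepresentatives.finite {n : ℕ} {R : Set (Fin n → A)}
    (hR : IsOrbitRepresentatives L R) (h : (orbits L A n).Finite) : R.Finite := by
  refine Set.Finite.of_finite_image (f := orbit L) (h.subset ?_) fun s hs t ht hst => ?_
  · rintro _ ⟨t, -, rfl⟩
    exact ⟨t, rfl⟩
  · refine (hR (orbit L s) ⟨s, rfl⟩).unique ⟨hs, self_mem_orbit s⟩ ⟨ht, ?_⟩
    rw [hst]
    exact self_mem_orbit t

theorem finite_entriesSubstructure [L.IsRelational] {n : ℕ} {R : Set (Fin n → A)}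
    (hR : R.Finite) : Finite (entriesSubstructure L R) := by
  have h : {a | ∃ t ∈ R, a ∈ Set.range t} = ⋃ t ∈ R, Set.range t := by
    ext
    simp
  have : {a | ∃ t ∈ R, a ∈ Set.range t}.Finite := by
    rw [h]
    exact hR.biUnion fun t _ => Set.finite_range t
  exact this.to_subtype

theorem IsOrbitRepresentatives.exists_equiv_mem [L.IsRelational] {n m : ℕ} (hmn : m ≤ n)
    {R : Set (Fin n → A)} (hR : IsOrbitRepresentatives L R) (a : Fin m → A) :
    ∃ f : A ≃[L] A, ∀ i, f (a i) ∈ entriesSubstructure L R := by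
  rcases isEmpty_or_nonempty A with hE | hE
  · exact ⟨Language.Equiv.refl L A, fun i => (hE.false (a i)).elim⟩
  -- Representatives exist only for `n`-tuples, so the shorter tuple is padded.
  let a' : Fin n → A := fun i => if h : i.1 < m then a ⟨i, h⟩ else Classical.arbitrary A
  obtain ⟨t, ⟨htR, f, rfl⟩, -⟩ := hR (orbit L a') ⟨a', rfl⟩
  exact ⟨f, fun i => ⟨_, htR, Fin.castLE hmn i, by simp [a']⟩⟩

theorem satIn_entriesSubstructure_iff [L.IsRelational] {n m : ℕ} (hmn : m ≤ n)
    {R : Set (Fin n → A)} (hR : IsOrbitRepresentatives L R) {φ : L.Formula (Fin m)}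
    (hφ : BoundedFormula.IsQF φ) : SatIn φ (entriesSubstructure L R) ↔ SatIn φ A := by
  have key (b : Fin m → entriesSubstructure L R) :
      φ.Realize ((entriesSubstructure L R).subtype ∘ b) ↔ φ.Realize b := by
    have := hφ.realize_embedding (entriesSubstructure L R).subtype (v := b) (xs := default)
    rwa [Subsingleton.elim (_ ∘ (default : Fin 0 → _)) default] at this
  constructor
  · rintro ⟨b, hb⟩
    exact ⟨_, (key b).2 hb⟩
  · rintro ⟨a, ha⟩
    obtain ⟨f, hf⟩ := hR.exists_equiv_mem hmn a
    refine ⟨fun i => ⟨f (a i), hf i⟩, (key _).1 ?_⟩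
    exact (StrongHomClass.realize_formula f φ (v := a)).2 ha

end Orbits

/-! ### From models of `T` to the finite samples. -/

section Sampling

variable {L : FirstOrder.Language.{u, v}}

theorem isQF_conj {α : Type} {l : List (L.Formula α)} (h : ∀ θ ∈ l, BoundedFormula.IsQF θ) :
    BoundedFormula.IsQF (conj l) := by
  induction l with
  | nil => exact .top
  | cons θ l ih =>
    simp only [List.mem_cons, forall_eq_or_imp] at h
    exact h.1.inf (ih h.2)

theorem IsAtomicConj.isQF {α : Type} {φ : L.Formula α} (h : IsAtomicConj φ) :
    BoundedFormula.IsQF φ := by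
  obtain ⟨l, hl, rfl⟩ := h
  refine isQF_conj fun θ hθ => ?_
  rcases hl θ hθ with h | rfl
  exacts [h.isQF, BoundedFormula.isQF_bot]

theorem IsEqualityConj.isQF {α : Type} {ψ : L.Formula α} (h : IsEqualityConj ψ) :
    BoundedFormula.IsQF ψ := by
  obtain ⟨l, hl, rfl⟩ := h
  refine isQF_conj fun θ hθ => ?_
  obtain ⟨i, j, rfl | rfl⟩ := hl θ hθ
  exacts [(BoundedFormula.IsAtomic.equal _ _).isQF, (BoundedFormula.IsAtomic.equal _ _).isQF.not]

/-- Any two countable models of an `ω`-categorical theory are isomorphic. -/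
theorem IsOmegaCategorical.nonempty_equiv {T : L.Theory} (hT : IsOmegaCategorical.{u, v, w} T)
    (A B : Type w) [L.Structure A] [L.Structure B] [Countable A] [Countable B]
    (hA : A ⊨ T) (hB : B ⊨ T) : Nonempty (A ≃[L] B) := by
  obtain ⟨C, _, _, hC⟩ := hT
  obtain ⟨e⟩ := hC (Bundled.of A) ‹_› hA
  obtain ⟨e'⟩ := hC (Bundled.of B) ‹_› hB
  exact ⟨e'.comp e.symm⟩

/-- A countable elementary substructure containing the satisfying tuple is again a model of `T`,
hence a copy of `A`. -/
theorem satInSomeModel_iff [Countable L.Symbols] {T : L.Theory}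
    (hT : IsOmegaCategorical.{u, v, w} T) (A : Type w) [L.Structure A] [Countable A]
    (hA : A ⊨ T) {α : Type} [Countable α] (φ : L.Formula α) :
    SatInSomeModel.{u, v, w} T φ ↔ SatIn φ A := by
  refine ⟨?_, fun h => ⟨Bundled.of A, hA, h⟩⟩
  rintro ⟨M, hM, a, ha⟩
  obtain ⟨S, haS, hS⟩ :=
    exists_countable_elementarySubstructure (L := L) (Set.range a) (Set.countable_range a)
  have hST : S ⊨ T := (S.elementarilyEquivalent.theory_model_iff).2 hM
  obtain ⟨e⟩ := hT.nonempty_equiv S A hST hA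
  let a' : α → S := fun i => ⟨a i, haS ⟨i, rfl⟩⟩
  exact ⟨e ∘ a', (StrongHomClass.realize_formula e φ).2 ((S.subtype.map_formula φ a').1 ha)⟩

theorem countable_symbols [L.IsRelational] [Finite (Σ n, L.Relations n)] :
    Countable L.Symbols :=
  inferInstanceAs (Countable ((Σ n, L.Functions n) ⊕ (Σ n, L.Relations n)))

theorem IsOmegaCategorical.isCountablyCategorical {T : L.Theory}
    (hT : IsOmegaCategorical.{u, v, w} T) {A : Type w} [L.Structure A] [Countable A]
    (hA : A ⊨ T) : IsCountablyCategorical L A :=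
  fun B _ _ h => hT.nonempty_equiv B A (h.theory_model_iff.1 hA) hA

theorem IsOmegaCategorical.isEqualityMatchingSampling [L.IsRelational] [Countable L.Symbols]
    {T : L.Theory} (hT : IsOmegaCategorical.{u, v, w} T) (A : Type w) [L.Structure A]
    [Countable A] (hA : A ⊨ T) (R : (n : ℕ) → Set (Fin n → A))
    (hR : ∀ n, IsOrbitRepresentatives L (R n)) :
    IsEqualityMatchingSampling T
      (fun n => {Bundled.of (c := L.Structure) (entriesSubstructure L (R n))}) := by
  have key (n m : ℕ) (hmn : m ≤ n) (φ : L.Formula (Fin m)) (hφ : BoundedFormula.IsQF φ) :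
      SatInSomeModel.{u, v, w} T φ ↔
        ∃ B ∈ ({Bundled.of (c := L.Structure) (entriesSubstructure L (R n))} :
          Set (Bundled.{w} L.Structure)), SatIn φ B := by
    rw [satInSomeModel_iff hT A hA, ← satIn_entriesSubstructure_iff hmn (hR n) hφ]
    refine ⟨fun h => ⟨_, rfl, h⟩, ?_⟩
    rintro ⟨_, rfl, h⟩
    exact h
  refine ⟨⟨fun n => Set.finite_singleton _, ?_, ?_⟩, ?_⟩
  · rintro n _ rfl
    exact finite_entriesSubstructure
      ((hR n).finite ((hT.isCountablyCategorical hA).finite_orbits n))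
  · exact fun n m hmn φ hφ => key n m hmn φ hφ.isQF
  · exact fun n m hmn φ ψ hφ hψ => key n m hmn _ (hφ.isQF.inf hψ.isQF)

end Sampling

end Sampling

theorem mainTheorem6 {L : FirstOrder.Language.{u, v}} [L.IsRelational] [Finite (Σ n, L.Relations n)]
    (T : L.Theory) (hT : Sampling.IsOmegaCategorical.{u, v, w} T) :
    (∃ S : ℕ → Set (Bundled.{w} L.Structure), Sampling.IsEqualityMatchingSampling T S) ∧
    ∀ (A : Type w) [L.Structure A] [Countable A], A ⊨ T →
      (∀ n : ℕ, (Sampling.orbits L A n).Finite) ∧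
      ∀ R : (n : ℕ) → Set (Fin n → A), (∀ n, Sampling.IsOrbitRepresentatives L (R n)) →
        Sampling.IsEqualityMatchingSampling T
          (fun n => {Bundled.of (c := L.Structure) (Sampling.entriesSubstructure L (R n))}) := by
  have := Sampling.countable_symbols (L := L)
  refine ⟨?_, fun A _ _ hA => ⟨(hT.isCountablyCategorical hA).finite_orbits,
    hT.isEqualityMatchingSampling A hA⟩⟩
  obtain ⟨A, hc, hA, -⟩ := id hT
  choose R hR using fun n => Sampling.exists_isOrbitRepresentatives L A n
  exact ⟨_, hT.isEqualityMatchingSampling A hA R hR⟩
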